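/- Let $\Gamma$ be a countable discrete amenable group and let $(H_i)_{i\in\mathbb N}$ be a Følner sequence in $\Gamma$, i.e. finite subsets, nonempty for all large $i$, with $\#(gH_i\,\triangle\,H_i)/\#H_i\to 0$ for every $g\in\Gamma$. For a measure-preserving action $T=\{T_\gamma\}_{\gamma\in\Gamma}$ of $\Gamma$ on a standard probability space $(X,\mathcal B,\mu)$, a finite measurable partition $P$ of $X$ and a $T$-invariant sub-$\sigma$-algebra $\mathcal A\subseteq\mathcal B$, put $$h(T,P)=\lim_{i\to\infty}\frac1{\#H_i}\,h\Big(\bigvee_{\gamma\in H_i}T_{\gamma^{-1}}(P)\Big),\qquad h(T,P\mid\mathcal A)=\inf\{h(T,P\vee Q)-h(T,Q): Q\text{ a finite }\mathcal A\text{-measurable partition}\},$$ where $T_{\gamma^{-1}}(P)$ denotes the partition into the sets $T_\gamma^{-1}(p)$, $p\in P$, and $h(\cdot)$ on the right of the first formula is the Shannon entropy of a partition with respect to $\mu$. The Pinsker algebra $\Pi(T)$ is the $\sigma$-algebra generated by all finite measurable partitions $P$ with $h(T,P)=0$, and the relative Pinsker algebra of $T$ over $\mathcal A$ is the $\sigma$-algebra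 generated by all finite measurable partitions $P$ with $h(T,P\mid\mathcal A)=0$. **Theorem 4.10.** Let $T_1$ and $T_2$ be ergodic measure-preserving actions of $\Gamma$ on standard probability spaces $(X_1,\mathcal B_1,\mu_1)$ and $(X_2,\mathcal B_2,\mu_2)$. Let $C(T_1)$ be the group of all bimeasurable, measure-preserving bijections $S$ of $X_1$ that commute with the action, i.e. $S\circ T_{1,\gamma}=T_{1,\gamma}\circ S$ $\mu_1$-almost everywhere for every $\gamma\in\Gamma$. Suppose that $C(T_1)$ acts ergodically on $X_1$: every measurable $A\subseteq X_1$ with $\mu_1(S^{-1}A\,\triangle\,A)=0$ for all $S\in C(T_1)$ has measure $0$ or $1$. Let $\mathcal E$ be the relative Pinsker algebra of the diagonal product action $T_1\times T_2=\{T_{1,\gamma}\times T_{2,\gamma}\}_{\gamma\in\Gamma}$ on $(X_1\times X_2,\mu_1\times\mu_2)$ over the first coordinate algebra $\{B\times X_2: B\in\mathcal B_1\}$. Then $$\mathcal E=\mathcal B_1\times\Pi(T_2)$$ modulo $\mu_1\times\mu_2$-null sets; that is, the two $\sigma$-algebras have the same completion: each set of either one differs from some set of the other by a null set. -/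

import Mathlib

open MeasureTheory Filter Topology

namespace AmenableEntropy

noncomputable section

/-- A sequence of finite subsets of the discrete group `Γ` is a (left) Følner sequence:
`H i` is eventually nonempty, and `#(g H_i ∆ H_i) / #H_i → 0` for every `g`. -/
def IsFolnerSeq {Γ : Type*} [Group Γ] (H : ℕ → Finset Γ) : Prop :=
  letI : MeasurableSpace Γ := ⊤
  IsFoelner Γ (Measure.count : Measure Γ) atTop (fun i => (H i : Set Γ))

/-- The Shannon entropy `h(P)` of a finite partition, given as a labelling map `P : X → σ`. -/
def partitionEntropy {X σ : Type*} [MeasurableSpace X] [Fintype σ] (μ : Measure X)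
    (P : X → σ) : ℝ :=
  ∑ s, Real.negMulLog (μ.real (P ⁻¹' {s}))

/-- The join `⋁_{γ ∈ F} T_{γ⁻¹}(P)`: the label of `x` is the name `γ ↦ P (T_γ x)`, `γ ∈ F`. -/
def joinOver {Γ X σ : Type*} [SMul Γ X] (P : X → σ) (F : Finset Γ) : X → (F → σ) :=
  fun x γ => P ((γ : Γ) • x)

open Classical in
/-- The entropy of the process `(T, P)`,
`h(T, P) = lim_i (1 / #H_i) h(⋁_{γ ∈ H_i} T_{γ⁻¹}(P))`. -/
def processEntropy {Γ X σ : Type*} [SMul Γ X] [MeasurableSpace X] [Fintype σ]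
    (H : ℕ → Finset Γ) (μ : Measure X) (P : X → σ) : ℝ :=
  limUnder atTop (fun i => ((H i).card : ℝ)⁻¹ * partitionEntropy μ (joinOver P (H i)))

/-- The conditional entropy `h(T, P | 𝒜)`: the infimum of `h(T, P ∨ Q) - h(T, Q)` over all finite
`𝒜`-measurable partitions `Q`. -/
def condProcessEntropy {Γ X σ : Type*} [SMul Γ X] (𝒜 : MeasurableSpace X) [MeasurableSpace X]
    [Fintype σ] (H : ℕ → Finset Γ) (μ : Measure X) (P : X → σ) : ℝ :=
  sInf {r : ℝ | ∃ (k : ℕ) (Q : X → Fin k), Measurable[𝒜] Q ∧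
    r = processEntropy H μ (fun x => (P x, Q x)) - processEntropy H μ Q}

/-- The Pinsker algebra: the σ-algebra generated by all finite measurable partitions `P` with
`h(T, P) = 0`. -/
@[reducible]
def pinskerAlgebra {Γ X : Type*} [SMul Γ X] [MeasurableSpace X]
    (H : ℕ → Finset Γ) (μ : Measure X) : MeasurableSpace X :=
  MeasurableSpace.generateFrom {s | ∃ (k : ℕ) (P : X → Fin k) (j : Fin k),
    Measurable P ∧ processEntropy H μ P = 0 ∧ s = P ⁻¹' {j}}

/-- The relative Pinsker algebra over `𝒜`: the σ-algebra generated by all finite measurable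
partitions `P` with `h(T, P | 𝒜) = 0`. -/
@[reducible]
def relativePinskerAlgebra {Γ X : Type*} [SMul Γ X] (𝒜 : MeasurableSpace X) [MeasurableSpace X]
    (H : ℕ → Finset Γ) (μ : Measure X) : MeasurableSpace X :=
  MeasurableSpace.generateFrom {s | ∃ (k : ℕ) (P : X → Fin k) (j : Fin k),
    Measurable P ∧ condProcessEntropy 𝒜 H μ P = 0 ∧ s = P ⁻¹' {j}}

/-- The group `C(T)` of all bimeasurable measure-preserving bijections of `X` that commute (almost
everywhere) with every element of the action of `Γ`. As a group of permutations it acts on `X`. -/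
def centralizer (Γ : Type*) {X : Type*} [Group Γ] [MulAction Γ X] [MeasurableSpace X]
    (μ : Measure X) : Subgroup (Equiv.Perm X) where
  carrier := {S | MeasurePreserving S μ μ ∧ MeasurePreserving S.symm μ μ ∧
    ∀ γ : Γ, ∀ᵐ x ∂μ, S (γ • x) = γ • S x}
  one_mem' := ⟨MeasurePreserving.id μ, MeasurePreserving.id μ, fun _ => ae_of_all _ fun _ => rfl⟩
  mul_mem' := by
    rintro S R ⟨hS, hS', hSc⟩ ⟨hR, hR', hRc⟩
    refine ⟨hS.comp hR, hR'.comp hS', fun γ => ?_⟩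
    filter_upwards [hRc γ, hR.quasiMeasurePreserving.ae (hSc γ)] with x h1 h2
    simp only [Equiv.Perm.mul_apply, h1, h2]
  inv_mem' := by
    rintro S ⟨hS, hS', hSc⟩
    refine ⟨hS', hS, fun γ => ?_⟩
    filter_upwards [hS'.quasiMeasurePreserving.ae (hSc γ)] with x h
    change S.symm (γ • x) = γ • S.symm x
    rw [Equiv.symm_apply_eq, h, Equiv.apply_symm_apply]

end

end AmenableEntropy

/-!
# The relative Pinsker algebra of a product over a factor with ergodic centralizer

Let `ℰ` be the relative Pinsker algebra of `T₁ × T₂` over the first coordinate. If `S` commutes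
with `T₁`, then `S × id` commutes with `T₁ × T₂` and preserves the first coordinate algebra, so it
preserves `ℰ` (`measurable_relativePinskerAlgebra`). Hence the conditional expectation on `ℰ` of a
cylinder `X₁ × B` is invariant under all `S × id`, and as the centralizer of `T₁` is ergodic, it is
a function `w_B` of the second coordinate alone (`ae_eq_integral_of_forall_smul_ae_eq`). The level
sets of `w_B` are cylinders in `ℰ`; by the independence of the coordinates their entropy over the
first coordinate is their entropy for `T₂`, so `w_B` is measurable for the Pinsker algebra of `T₂`
(`exists_condExp_cylinder_ae_eq`). Since `ℰ` contains the first coordinate algebra, the functions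
`w_B` determine `ℰ`: it is `B₁ × Π(T₂)` up to null sets (`exists_ae_eq_of_condExp_cylinder`).

This uses that a set of `ℰ`, a σ-algebra given by generators, itself has zero entropy over the
first coordinate: such sets form a σ-algebra (`zeroCondEntropyAlgebra`), by the subadditivity of
conditional entropy and its continuity `h(T, P | 𝒜) ≤ h(T, P' | 𝒜) + H(P | P')`. Everything about
entropy comes from the submodularity of Shannon entropy (`partitionEntropy_submodular`). In
particular the limit defining `h(T, P)` exists without any quasi-tiling: a Følner set `F` is covered
by the translates `K γ`, `γ ∈ K⁻¹ F`, each point exactly `#K` times, so Shearer's inequality gives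
`#K * H(P^F) ≤ #(K⁻¹ F) * H(P^K)`, and `#(K⁻¹ F) / #F → 1` along the Følner sequence; the limit is
the infimum of `H(P^K) / #K` (`exists_tendsto_of_submodular`).
-/

namespace AmenableEntropy

/-! ### Shannon entropy of finite partitions -/

section StaticEntropy

variable {X α β γ : Type*} [MeasurableSpace X] {μ : Measure X}

lemma measureReal_eq_sum_inter_preimage [IsFiniteMeasure μ] [Fintype β] [MeasurableSpace β]
    [MeasurableSingletonClass β] {Q : X → β} (hQ : Measurable Q) (s : Set X) :
    μ.real s = ∑ b, μ.real (Q ⁻¹' {b} ∩ s) := by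
  have h := sum_measureReal_preimage_singleton (μ := μ.restrict s) (Finset.univ : Finset β)
    (f := Q) (fun b _ => hQ (measurableSet_singleton b))
  simp only [Finset.coe_univ, Set.preimage_univ, measureReal_restrict_apply_univ] at h
  rw [← h]
  exact Finset.sum_congr rfl fun b _ =>
    measureReal_restrict_apply (hQ (measurableSet_singleton b))

lemma partitionEntropy_nonneg [IsProbabilityMeasure μ] [Fintype α] (P : X → α) :
    0 ≤ partitionEntropy μ P :=
  Finset.sum_nonneg fun _ _ => Real.negMulLog_nonneg measureReal_nonneg measureReal_le_one

lemma partitionEntropy_congr_ae [Fintype α] {P Q : X → α} (h : P =ᵐ[μ] Q) :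
    partitionEntropy μ P = partitionEntropy μ Q := by
  refine Finset.sum_congr rfl fun s _ => ?_
  rw [measureReal_congr]
  filter_upwards [h] with x hx
  exact congrArg (· = s) hx

lemma partitionEntropy_comp_measurePreserving {Y : Type*} [MeasurableSpace Y] {ν : Measure Y}
    [Fintype α] [MeasurableSpace α] [MeasurableSingletonClass α] {P : Y → α} (hP : Measurable P)
    {f : X → Y} (hf : MeasurePreserving f μ ν) :
    partitionEntropy μ (fun x => P (f x)) = partitionEntropy ν P := by
  refine Finset.sum_congr rfl fun s _ => ?_
  have h := hf.measureReal_preimage (hP (measurableSet_singleton s)).nullMeasurableSet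
  rw [← h]
  rfl

lemma partitionEntropy_of_subsingleton [IsProbabilityMeasure μ] [Fintype α] [Subsingleton α]
    (P : X → α) : partitionEntropy μ P = 0 := by
  refine Finset.sum_eq_zero fun s _ => ?_
  rw [Set.eq_univ_of_forall (s := P ⁻¹' {s}) fun x => Subsingleton.elim _ _]
  simp

lemma negMulLog_sum_le {ι : Type*} (s : Finset ι) (a : ι → ℝ) (ha : ∀ i ∈ s, 0 ≤ a i) :
    Real.negMulLog (∑ i ∈ s, a i) ≤ ∑ i ∈ s, Real.negMulLog (a i) := by
  rw [Real.negMulLog, ← Finset.sum_neg_distrib, Finset.sum_mul]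
  refine Finset.sum_le_sum fun i hi => ?_
  rcases (ha i hi).eq_or_lt with h | h
  · simp [← h]
  · have := Real.log_le_log h (Finset.single_le_sum ha hi)
    simp only [Real.negMulLog]
    nlinarith

/-- A partition has at most the entropy of any partition that refines it. -/
lemma partitionEntropy_le_of_coarser [IsFiniteMeasure μ] [Fintype α] [Fintype β]
    [MeasurableSpace β] [MeasurableSingletonClass β] {Q : X → β} (hQ : Measurable Q)
    {P : X → α} (φ : β → α) (h : ∀ x, P x = φ (Q x)) :
    partitionEntropy μ P ≤ partitionEntropy μ Q := by
  classical
  have key : ∀ a, μ.real (P ⁻¹' {a}) = ∑ b with φ b = a, μ.real (Q ⁻¹' {b}) := by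
    intro a
    rw [measureReal_eq_sum_inter_preimage hQ, Finset.sum_filter]
    refine Finset.sum_congr rfl fun b _ => ?_
    split_ifs with hb
    · congr 1
      ext x
      simp only [Set.mem_inter_iff, Set.mem_preimage, Set.mem_singleton_iff, h]
      constructor
      · exact fun h => h.1
      · rintro rfl
        exact ⟨rfl, hb⟩
    · rw [Set.eq_empty_of_forall_notMem (s := Q ⁻¹' {b} ∩ P ⁻¹' {a}), measureReal_empty]
      rintro x ⟨h1, h2⟩
      simp only [Set.mem_preimage, Set.mem_singleton_iff, h] at h1 h2
      exact hb (h1 ▸ h2)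
  calc partitionEntropy μ P
      ≤ ∑ a, ∑ b with φ b = a, Real.negMulLog (μ.real (Q ⁻¹' {b})) := by
        refine Finset.sum_le_sum fun a _ => ?_
        rw [key]
        exact negMulLog_sum_le _ _ fun _ _ => measureReal_nonneg
    _ = partitionEntropy μ Q :=
        Finset.sum_fiberwise Finset.univ φ fun b => Real.negMulLog (μ.real (Q ⁻¹' {b}))

lemma partitionEntropy_eq_of_equivalent [IsFiniteMeasure μ] [Fintype α] [Fintype β]
    [MeasurableSpace α] [MeasurableSingletonClass α]
    [MeasurableSpace β] [MeasurableSingletonClass β] {P : X → α} (hP : Measurable P)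
    {Q : X → β} (hQ : Measurable Q) (φ : β → α) (h : ∀ x, P x = φ (Q x))
    (ψ : α → β) (h' : ∀ x, Q x = ψ (P x)) :
    partitionEntropy μ P = partitionEntropy μ Q :=
  (partitionEntropy_le_of_coarser hQ φ h).antisymm (partitionEntropy_le_of_coarser hP ψ h')

/-- Gibbs' inequality `log t ≤ t - 1` for one atom of a triple join; summed over all atoms it is
the submodularity of entropy. -/
lemma mul_log_le_of_marginals {p u v w : ℝ} (hp : 0 ≤ p) (hu : p ≤ u) (hv : p ≤ v) (huw : u ≤ w) :
    Real.negMulLog p + p * (-Real.log w) ≤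
      p * (-Real.log u) + p * (-Real.log v) + (u * v / w - p) := by
  rcases hp.eq_or_lt with rfl | h
  · simp only [Real.negMulLog_zero, zero_mul, add_zero, sub_zero, zero_add]
    exact div_nonneg (mul_nonneg hu hv) (hu.trans huw)
  · have hu0 : 0 < u := h.trans_le hu
    have hv0 : 0 < v := h.trans_le hv
    have hw0 : 0 < w := hu0.trans_le huw
    have key := Real.log_le_sub_one_of_pos (x := u * v / (w * p)) (by positivity)
    rw [Real.log_div (by positivity) (by positivity), Real.log_mul hu0.ne' hv0.ne',
      Real.log_mul hw0.ne' h.ne'] at key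
    have h2 := mul_le_mul_of_nonneg_left key hp
    have h3 : p * (u * v / (w * p) - 1) = u * v / w - p := by field_simp
    rw [h3] at h2
    simp only [Real.negMulLog]
    linarith

/-- Submodularity of Shannon entropy: `H(P ∨ Q ∨ R) + H(R) ≤ H(P ∨ R) + H(Q ∨ R)`. -/
lemma partitionEntropy_submodular [IsFiniteMeasure μ] [Fintype α] [Fintype β] [Fintype γ]
    [MeasurableSpace α] [MeasurableSingletonClass α] [MeasurableSpace β]
    [MeasurableSingletonClass β] [MeasurableSpace γ] [MeasurableSingletonClass γ]
    {P : X → α} {Q : X → β} {R : X → γ} (hP : Measurable P) (hQ : Measurable Q) :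
    partitionEntropy μ (fun x => (P x, Q x, R x)) + partitionEntropy μ R ≤
      partitionEntropy μ (fun x => (P x, R x)) + partitionEntropy μ (fun x => (Q x, R x)) := by
  set p : α → β → γ → ℝ := fun a b c => μ.real ((fun x => (P x, Q x, R x)) ⁻¹' {(a, b, c)})
  set u : α → γ → ℝ := fun a c => μ.real ((fun x => (P x, R x)) ⁻¹' {(a, c)})
  set v : β → γ → ℝ := fun b c => μ.real ((fun x => (Q x, R x)) ⁻¹' {(b, c)})
  set w : γ → ℝ := fun c => μ.real (R ⁻¹' {c})
  have hpu : ∀ a c, u a c = ∑ b, p a b c := by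
    intro a c
    simp only [u, p]
    rw [measureReal_eq_sum_inter_preimage hQ]
    refine Finset.sum_congr rfl fun b _ => ?_
    congr 1; ext x; simp; tauto
  have hpv : ∀ b c, v b c = ∑ a, p a b c := by
    intro b c
    simp only [v, p]
    rw [measureReal_eq_sum_inter_preimage hP]
    refine Finset.sum_congr rfl fun a _ => ?_
    congr 1; ext x; simp
  have huw : ∀ c, w c = ∑ a, u a c := by
    intro c
    simp only [w, u]
    rw [measureReal_eq_sum_inter_preimage hP]
    refine Finset.sum_congr rfl fun a _ => ?_
    congr 1; ext x; simp
  have hvw : ∀ c, w c = ∑ b, v b c := by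
    intro c
    simp only [w, v]
    rw [measureReal_eq_sum_inter_preimage hQ]
    refine Finset.sum_congr rfl fun a _ => ?_
    congr 1; ext x; simp
  have hp0 : ∀ a b c, 0 ≤ p a b c := fun _ _ _ => measureReal_nonneg
  have hu0 : ∀ a c, 0 ≤ u a c := fun _ _ => measureReal_nonneg
  have e1 : partitionEntropy μ (fun x => (P x, Q x, R x)) =
      ∑ c, ∑ a, ∑ b, Real.negMulLog (p a b c) := by
    simp only [partitionEntropy, Fintype.sum_prod_type]
    conv_rhs => rw [Finset.sum_comm]
    refine Finset.sum_congr rfl fun a _ => ?_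
    rw [Finset.sum_comm]
  have e2 : partitionEntropy μ R = ∑ c, ∑ a, ∑ b, p a b c * (-Real.log (w c)) := by
    refine Finset.sum_congr rfl fun c _ => ?_
    simp only [← Finset.sum_mul, ← hpu, ← huw, Real.negMulLog]
    change -w c * Real.log (w c) = _
    ring
  have e3 : partitionEntropy μ (fun x => (P x, R x)) =
      ∑ c, ∑ a, ∑ b, p a b c * (-Real.log (u a c)) := by
    simp only [partitionEntropy, Fintype.sum_prod_type]
    rw [Finset.sum_comm]
    refine Finset.sum_congr rfl fun c _ => Finset.sum_congr rfl fun a _ => ?_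
    rw [← Finset.sum_mul, ← hpu, Real.negMulLog]
    change -u a c * Real.log (u a c) = _
    ring
  have e4 : partitionEntropy μ (fun x => (Q x, R x)) =
      ∑ c, ∑ a, ∑ b, p a b c * (-Real.log (v b c)) := by
    simp only [partitionEntropy, Fintype.sum_prod_type]
    rw [Finset.sum_comm]
    refine Finset.sum_congr rfl fun c _ => ?_
    rw [Finset.sum_comm]
    refine Finset.sum_congr rfl fun b _ => ?_
    rw [← Finset.sum_mul, ← hpv, Real.negMulLog]
    change -v b c * Real.log (v b c) = _
    ring
  have e5 : ∑ c, ∑ a, ∑ b, (u a c * v b c / w c - p a b c) = 0 := by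
    refine Finset.sum_eq_zero fun c _ => ?_
    simp only [Finset.sum_sub_distrib, ← hpu, ← Finset.sum_div, ← Finset.mul_sum, ← hvw,
      ← Finset.sum_mul, ← huw]
    rcases eq_or_ne (w c) 0 with h | h
    · simp [h]
    · field_simp
      ring
  rw [e1, e2, e3, e4]
  refine le_of_le_of_eq (b := _ + ∑ c, ∑ a, ∑ b, (u a c * v b c / w c - p a b c)) ?_
    (by rw [e5, add_zero])
  simp only [← Finset.sum_add_distrib]
  refine Finset.sum_le_sum fun c _ => Finset.sum_le_sum fun a _ => Finset.sum_le_sum fun b _ => ?_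
  refine mul_log_le_of_marginals (hp0 a b c) ?_ ?_ ?_
  · rw [hpu]
    exact Finset.single_le_sum (f := fun b => p a b c) (fun b _ => hp0 a b c) (Finset.mem_univ b)
  · rw [hpv]
    exact Finset.single_le_sum (f := fun a => p a b c) (fun a _ => hp0 a b c) (Finset.mem_univ a)
  · rw [huw]
    exact Finset.single_le_sum (f := fun a => u a c) (fun a _ => hu0 a c) (Finset.mem_univ a)

/-- Entropy is additive over independent partitions. -/
lemma partitionEntropy_prod_of_indep [IsProbabilityMeasure μ] [Fintype α] [Fintype β]
    [MeasurableSpace α] [MeasurableSingletonClass α] [MeasurableSpace β]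
    [MeasurableSingletonClass β] {P : X → α} {Q : X → β} (hP : Measurable P) (hQ : Measurable Q)
    (h : ∀ a b, μ.real (P ⁻¹' {a} ∩ Q ⁻¹' {b}) = μ.real (P ⁻¹' {a}) * μ.real (Q ⁻¹' {b})) :
    partitionEntropy μ (fun x => (P x, Q x)) = partitionEntropy μ P + partitionEntropy μ Q := by
  have hP1 : ∑ a, μ.real (P ⁻¹' {a}) = 1 := by
    simpa using (measureReal_eq_sum_inter_preimage (μ := μ) hP Set.univ).symm
  have hQ1 : ∑ b, μ.real (Q ⁻¹' {b}) = 1 := by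
    simpa using (measureReal_eq_sum_inter_preimage (μ := μ) hQ Set.univ).symm
  have : ∀ a b, Real.negMulLog (μ.real ((fun x => (P x, Q x)) ⁻¹' {(a, b)})) =
      μ.real (Q ⁻¹' {b}) * Real.negMulLog (μ.real (P ⁻¹' {a})) +
        μ.real (P ⁻¹' {a}) * Real.negMulLog (μ.real (Q ⁻¹' {b})) := by
    intro a b
    rw [← Real.negMulLog_mul, ← h]
    congr 2
    ext x
    simp
  simp only [partitionEntropy, Fintype.sum_prod_type, this, Finset.sum_add_distrib,
    ← Finset.sum_mul, ← Finset.mul_sum, hP1, hQ1, one_mul]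

end StaticEntropy

/-! ### Submodular set functions along Følner sequences -/

section Shearer

open scoped symmDiff Pointwise

open Classical in
/-- Shearer's inequality for a set function which is submodular (in the form of diminishing
increments): if each point of `F` lies in exactly `n` of the sets `A j`, then
`n f(F) ≤ ∑ f(A_j ∩ F)`. -/
lemma shearer_inequality {Γ ι : Type*} {f : Finset Γ → ℝ} (h0 : f ∅ = 0)
    (hsub : ∀ a F G, G ⊆ F → f (insert a F) + f G ≤ f (insert a G) + f F)
    (J : Finset ι) (A : ι → Finset Γ) (n : ℕ) (F : Finset Γ)
    (hA : ∀ a ∈ F, (J.filter fun j => a ∈ A j).card = n) :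
    n * f F ≤ ∑ j ∈ J, f (A j ∩ F) := by
  induction F using Finset.induction_on with
  | empty => simp [h0]
  | insert a F ha ih =>
    have ih := ih fun b hb => hA b (Finset.mem_insert_of_mem hb)
    have hj : ∀ j ∈ J, (if a ∈ A j then f (insert a F) - f F else 0) ≤
        f (A j ∩ insert a F) - f (A j ∩ F) := by
      intro j _
      split_ifs with h
      · rw [Finset.inter_insert_of_mem h]
        linarith [hsub a F (A j ∩ F) Finset.inter_subset_right]
      · rw [Finset.inter_insert_of_notMem h, sub_self]
    have hs := Finset.sum_le_sum hj
    rw [← Finset.sum_filter, Finset.sum_const, hA a (Finset.mem_insert_self _ _),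
      Finset.sum_sub_distrib, nsmul_eq_mul] at hs
    linarith

variable {Γ : Type*} [Group Γ]

open Classical in
/-- The set `K⁻¹ F`, that is, the set of all `γ` such that the translate `K γ` meets `F`. -/
noncomputable def translatesMeeting (K F : Finset Γ) : Finset Γ :=
  K.biUnion fun k => F.image fun a => k⁻¹ * a

open Classical in
/-- The set `F` is covered exactly `#K` times by the right translates `K γ`, `γ ∈ K⁻¹ F`, so that
Shearer's inequality compares `f F` with `f K`. -/
lemma card_mul_le_card_translatesMeeting_mul {f : Finset Γ → ℝ} (h0 : f ∅ = 0)
    (hmono : ∀ F G, G ⊆ F → f G ≤ f F)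
    (hsub : ∀ a F G, G ⊆ F → f (insert a F) + f G ≤ f (insert a G) + f F)
    (hinv : ∀ F g, f (F.image (· * g)) = f F) (K F : Finset Γ) :
    K.card * f F ≤ (translatesMeeting K F).card * f K := by
  refine (shearer_inequality h0 hsub (translatesMeeting K F) (fun g => K.image (· * g)) K.card F
    fun a ha => ?_).trans ?_
  · have : (translatesMeeting K F).filter (fun g => a ∈ K.image (· * g)) =
        K.image fun k => k⁻¹ * a := by
      ext g
      simp only [translatesMeeting, Finset.mem_filter, Finset.mem_biUnion, Finset.mem_image]
      constructor
      · rintro ⟨-, k, hk, rfl⟩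
        exact ⟨k, hk, by group⟩
      · rintro ⟨k, hk, rfl⟩
        exact ⟨⟨k, hk, a, ha, rfl⟩, k, hk, by group⟩
    rw [this, Finset.card_image_of_injective]
    intro k l h
    simpa using h
  · rw [← nsmul_eq_mul]
    refine Finset.sum_le_card_nsmul _ _ _ fun g _ => ?_
    rw [← hinv K g]
    exact hmono _ _ Finset.inter_subset_left

open Classical in
lemma IsFolnerSeq.tendsto_card_sdiff {H : ℕ → Finset Γ} (hH : IsFolnerSeq H) (g : Γ) :
    Tendsto (fun i => (((H i).image (fun a => g * a) \ H i).card : ℝ) / (H i).card)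
      atTop (𝓝 0) := by
  let _ : MeasurableSpace Γ := ⊤
  have h := (ENNReal.tendsto_toReal ENNReal.zero_ne_top).comp
    (IsFoelner.tendsto_meas_smul_symmDiff hH g)
  refine squeeze_zero (fun i => by positivity) (fun i => ?_) h
  have e : (g • (H i : Set Γ)) ∆ (H i : Set Γ) =
      ((((H i).image fun a => g * a) ∆ H i : Finset Γ) : Set Γ) := by
    rw [Finset.coe_symmDiff, Finset.coe_image]
    rfl
  simp only [Function.comp_apply, e, Measure.count_apply_finset, ENNReal.toReal_div,
    ENNReal.toReal_natCast]
  gcongr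
  exact Finset.subset_union_left

lemma IsFolnerSeq.eventually_nonempty {H : ℕ → Finset Γ} (hH : IsFolnerSeq H) :
    ∀ᶠ i in atTop, (H i).Nonempty := by
  let _ : MeasurableSpace Γ := ⊤
  filter_upwards [IsFoelner.eventually_meas_ne_zero hH] with i hi
  rw [Finset.nonempty_iff_ne_empty]
  rintro h
  simp [h] at hi

lemma IsFolnerSeq.tendsto_card_translatesMeeting {H : ℕ → Finset Γ} (hH : IsFolnerSeq H)
    (K : Finset Γ) :
    ∃ r : ℕ → ℝ, Tendsto r atTop (𝓝 1) ∧
      ∀ᶠ i in atTop, ((translatesMeeting K (H i)).card : ℝ) / (H i).card ≤ r i := by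
  classical
  refine ⟨fun i => 1 + ∑ k ∈ K,
    (((H i).image (fun a => k⁻¹ * a) \ H i).card : ℝ) / (H i).card, ?_, ?_⟩
  · simpa using (tendsto_const_nhds (x := (1 : ℝ))).add
      (tendsto_finsetSum K fun k _ => hH.tendsto_card_sdiff k⁻¹)
  · filter_upwards [hH.eventually_nonempty] with i hi
    have hpos : (0 : ℝ) < (H i).card := by exact_mod_cast hi.card_pos
    rw [← Finset.sum_div, div_le_iff₀ hpos, add_mul, div_mul_cancel₀ _ hpos.ne', one_mul]
    have hsubset : translatesMeeting K (H i) ⊆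
        H i ∪ K.biUnion fun k => (H i).image (fun a => k⁻¹ * a) \ H i := by
      intro g hg
      obtain ⟨k, hk, hg⟩ := Finset.mem_biUnion.1 hg
      by_cases h : g ∈ H i
      · exact Finset.mem_union_left _ h
      · exact Finset.mem_union_right _
          (Finset.mem_biUnion.2 ⟨k, hk, Finset.mem_sdiff.2 ⟨hg, h⟩⟩)
    exact_mod_cast (Finset.card_le_card hsubset).trans ((Finset.card_union_le _ _).trans
      (Nat.add_le_add_left Finset.card_biUnion_le _))

open Classical in
/-- A monotone, submodular, right-invariant set function has a density along every Følner
sequence, namely the infimum of `f(K) / #K` over all nonempty finite `K`. -/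
lemma exists_tendsto_of_submodular {H : ℕ → Finset Γ} (hH : IsFolnerSeq H)
    {f : Finset Γ → ℝ} (h0 : f ∅ = 0) (hmono : ∀ F G, G ⊆ F → f G ≤ f F)
    (hsub : ∀ a F G, G ⊆ F → f (insert a F) + f G ≤ f (insert a G) + f F)
    (hinv : ∀ F g, f (F.image (· * g)) = f F) :
    ∃ L, Tendsto (fun i => ((H i).card : ℝ)⁻¹ * f (H i)) atTop (𝓝 L) := by
  have hf : ∀ F, 0 ≤ f F := fun F => h0 ▸ hmono F ∅ (Finset.empty_subset F)
  set S : Set ℝ := (fun K : Finset Γ => (K.card : ℝ)⁻¹ * f K) '' {K | K.Nonempty}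
  have hbdd : BddBelow S := ⟨0, by
    rintro _ ⟨K, -, rfl⟩
    have := hf K
    positivity⟩
  have hne : S.Nonempty := ⟨_, {1}, Finset.singleton_nonempty 1, rfl⟩
  refine ⟨sInf S, tendsto_order.2 ⟨fun b hb => ?_, fun b hb => ?_⟩⟩
  -- The lower bound holds at every `i` because `H i` is itself one of the sets `K`.
  · filter_upwards [hH.eventually_nonempty] with i hi
    exact hb.trans_le (csInf_le hbdd ⟨_, hi, rfl⟩)
  · obtain ⟨_, ⟨K, hK, rfl⟩, hKb⟩ := exists_lt_of_csInf_lt hne hb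
    obtain ⟨r, hr, hle⟩ := hH.tendsto_card_translatesMeeting K
    have hlim := hr.mul_const ((K.card : ℝ)⁻¹ * f K)
    rw [one_mul] at hlim
    filter_upwards [hlim.eventually_lt_const hKb, hle] with i h1 h2
    refine lt_of_le_of_lt ?_ h1
    have hKpos : (0 : ℝ) < K.card := by exact_mod_cast Finset.card_pos.2 hK
    have key := card_mul_le_card_translatesMeeting_mul h0 hmono hsub hinv K (H i)
    have hfK := hf K
    calc ((H i).card : ℝ)⁻¹ * f (H i)
        = ((H i).card : ℝ)⁻¹ * (K.card : ℝ)⁻¹ * (K.card * f (H i)) := by field_simp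
      _ ≤ ((H i).card : ℝ)⁻¹ * (K.card : ℝ)⁻¹ * ((translatesMeeting K (H i)).card * f K) := by
        gcongr
      _ = ((translatesMeeting K (H i)).card : ℝ) / (H i).card * ((K.card : ℝ)⁻¹ * f K) := by ring
      _ ≤ r i * ((K.card : ℝ)⁻¹ * f K) := by gcongr

end Shearer

/-! ### Entropy of processes -/

section Dynamics

variable {Γ X : Type*} [Group Γ] [MulAction Γ X] [MeasurableSpace X] [MeasurableConstSMul Γ X]
variable {μ : Measure X}
variable {α β γ : Type*} [Fintype α] [Fintype β] [Fintype γ]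
  [MeasurableSpace α] [MeasurableSingletonClass α] [MeasurableSpace β] [MeasurableSingletonClass β]
  [MeasurableSpace γ] [MeasurableSingletonClass γ]

open Classical in
/-- The entropy of the join `⋁_{γ ∈ F} T_{γ⁻¹}(P)`. -/
noncomputable def jointEntropy (μ : Measure X) (P : X → α) (F : Finset Γ) : ℝ :=
  partitionEntropy μ (joinOver P F)

omit [MeasurableSingletonClass α] [Fintype α] in
lemma measurable_joinOver {P : X → α} (hP : Measurable P) (F : Finset Γ) :
    Measurable (joinOver P F) :=
  measurable_pi_lambda _ fun γ => hP.comp (measurable_const_smul (γ : Γ))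

omit [MeasurableConstSMul Γ X] [MeasurableSpace α] [MeasurableSingletonClass α] in
lemma jointEntropy_empty [IsProbabilityMeasure μ] (P : X → α) :
    jointEntropy μ P (∅ : Finset Γ) = 0 :=
  partitionEntropy_of_subsingleton _

lemma jointEntropy_mono [IsFiniteMeasure μ] {P : X → α} (hP : Measurable P) {F G : Finset Γ}
    (h : G ⊆ F) : jointEntropy μ P G ≤ jointEntropy μ P F := by
  classical
  exact partitionEntropy_le_of_coarser (measurable_joinOver hP F)
    (fun w g => w ⟨g, h g.2⟩) fun x => rfl

open Classical in
lemma jointEntropy_insert_le [IsFiniteMeasure μ] {P : X → α} (hP : Measurable P) (a : Γ)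
    {F G : Finset Γ} (h : G ⊆ F) :
    jointEntropy μ P (insert a F) + jointEntropy μ P G ≤
      jointEntropy μ P (insert a G) + jointEntropy μ P F := by
  have hPa : Measurable fun x => P (a • x) := hP.comp (measurable_const_smul a)
  have hF := measurable_joinOver hP F
  have hG := measurable_joinOver hP G
  have h1 := partitionEntropy_submodular (μ := μ) (R := joinOver P G) hPa hF
  have h2 : jointEntropy μ P (insert a F) ≤
      partitionEntropy μ (fun x => (P (a • x), joinOver P F x, joinOver P G x)) := by
    refine partitionEntropy_le_of_coarser (hPa.prodMk (hF.prodMk hG))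
      (fun w g => if hg : (g : Γ) ∈ F then w.2.1 ⟨g, hg⟩ else w.1) fun x => ?_
    funext g
    split_ifs with hg
    · rfl
    · have : (g : Γ) = a := (Finset.mem_insert.1 g.2).resolve_right hg
      simp only [joinOver, this]
  have h3 : partitionEntropy μ (fun x => (P (a • x), joinOver P G x)) ≤
      jointEntropy μ P (insert a G) :=
    partitionEntropy_le_of_coarser (measurable_joinOver hP (insert a G))
      (fun w => (w ⟨a, Finset.mem_insert_self a G⟩,
        fun g => w ⟨g, Finset.mem_insert_of_mem g.2⟩)) fun x => rfl
  have h4 : partitionEntropy μ (fun x => (joinOver P F x, joinOver P G x)) ≤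
      jointEntropy μ P F :=
    partitionEntropy_le_of_coarser hF (fun w => (w, fun g => w ⟨g, h g.2⟩)) fun x => rfl
  change _ + partitionEntropy μ (joinOver P G) ≤ _
  linarith

open Classical in
lemma jointEntropy_image_mul [IsProbabilityMeasure μ] [SMulInvariantMeasure Γ X μ] {P : X → α}
    (hP : Measurable P) (F : Finset Γ) (g : Γ) :
    jointEntropy μ P (F.image (· * g)) = jointEntropy μ P F := by
  have hF := measurable_joinOver hP F
  rw [jointEntropy, jointEntropy,
    ← partitionEntropy_comp_measurePreserving hF (measurePreserving_smul g μ)]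
  refine partitionEntropy_eq_of_equivalent (measurable_joinOver hP _)
    (hF.comp (measurable_const_smul g))
    (fun w b => w ⟨b * g⁻¹, ?_⟩) (fun x => ?_)
    (fun w b => w ⟨b * g, Finset.mem_image_of_mem _ b.2⟩) (fun x => ?_)
  · obtain ⟨c, hc, h⟩ := Finset.mem_image.1 b.2
    rw [← h]
    simpa using hc
  · funext b
    simp [joinOver, smul_smul]
  · funext b
    simp [joinOver, smul_smul]

/-- The limit in the definition of `processEntropy` exists. -/
lemma tendsto_processEntropy {H : ℕ → Finset Γ} (hH : IsFolnerSeq H) [IsProbabilityMeasure μ]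
    [SMulInvariantMeasure Γ X μ] {P : X → α} (hP : Measurable P) :
    Tendsto (fun i => ((H i).card : ℝ)⁻¹ * jointEntropy μ P (H i)) atTop
      (𝓝 (processEntropy H μ P)) :=
  tendsto_nhds_limUnder (exists_tendsto_of_submodular hH (jointEntropy_empty P)
    (fun _ _ => jointEntropy_mono hP) (fun a _ _ => jointEntropy_insert_le hP a)
    (jointEntropy_image_mul hP))

omit [MeasurableConstSMul Γ X] [MeasurableSpace α] [MeasurableSingletonClass α] in
lemma processEntropy_congr {Y : Type*} [MeasurableSpace Y] [MulAction Γ Y] {ν : Measure Y}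
    (H : ℕ → Finset Γ) {P : X → α} {Q : Y → α}
    (h : ∀ F : Finset Γ, jointEntropy μ P F = jointEntropy ν Q F) :
    processEntropy H μ P = processEntropy H ν Q := by
  have : (fun i => ((H i).card : ℝ)⁻¹ * jointEntropy μ P (H i)) =
      fun i => ((H i).card : ℝ)⁻¹ * jointEntropy ν Q (H i) := by simp only [h]
  exact congrArg (limUnder atTop) this

omit [MeasurableConstSMul Γ X] in
/-- A partition composed with a factor map, up to null sets, has the entropy of the partition of
the factor. -/
lemma processEntropy_comp {Y : Type*} [MeasurableSpace Y] [MulAction Γ Y]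
    [MeasurableConstSMul Γ Y] [Countable Γ] {ν : Measure Y}
    (H : ℕ → Finset Γ) {P : Y → α} (hP : Measurable P) {f : X → Y} (hf : MeasurePreserving f μ ν)
    (hfc : ∀ g : Γ, ∀ᵐ x ∂μ, f (g • x) = g • f x) :
    processEntropy H μ (fun x => P (f x)) = processEntropy H ν P := by
  classical
  refine processEntropy_congr H fun F => ?_
  rw [jointEntropy, jointEntropy,
    ← partitionEntropy_comp_measurePreserving (measurable_joinOver hP F) hf]
  refine partitionEntropy_congr_ae ?_
  filter_upwards [ae_all_iff.2 hfc] with x hx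
  funext g
  simp [joinOver, hx]

variable [IsProbabilityMeasure μ]

omit [MeasurableSpace α] [MeasurableSingletonClass α] in
lemma jointEntropy_le_of_coarser {P : X → α} {Q : X → β} (hQ : Measurable Q) (φ : β → α)
    (h : ∀ x, P x = φ (Q x)) (F : Finset Γ) : jointEntropy μ P F ≤ jointEntropy μ Q F := by
  classical
  exact partitionEntropy_le_of_coarser (measurable_joinOver hQ F) (fun w g => φ (w g))
    fun x => funext fun g => h _

open Classical in
lemma jointEntropy_prodMk {P : X → α} {Q : X → β} (hP : Measurable P) (hQ : Measurable Q)
    (F : Finset Γ) : jointEntropy μ (fun x => (P x, Q x)) F =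
      partitionEntropy μ (fun x => (joinOver P F x, joinOver Q F x)) := by
  exact partitionEntropy_eq_of_equivalent (measurable_joinOver (hP.prodMk hQ) F)
    ((measurable_joinOver hP F).prodMk (measurable_joinOver hQ F))
    (fun w g => (w.1 g, w.2 g)) (fun x => rfl) (fun w => (fun g => (w g).1, fun g => (w g).2))
    fun x => rfl

lemma jointEntropy_submodular {P : X → α} {Q : X → β} {R : X → γ} (hP : Measurable P)
    (hQ : Measurable Q) (hR : Measurable R) (F : Finset Γ) :
    jointEntropy μ (fun x => (P x, Q x, R x)) F + jointEntropy μ R F ≤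
      jointEntropy μ (fun x => (P x, R x)) F + jointEntropy μ (fun x => (Q x, R x)) F := by
  classical
  have hPF := measurable_joinOver hP F
  have hQF := measurable_joinOver hQ F
  have hRF := measurable_joinOver hR F
  rw [jointEntropy_prodMk hP hR, jointEntropy_prodMk hQ hR]
  refine le_trans (add_le_add ?_ le_rfl) (partitionEntropy_submodular (R := joinOver R F) hPF hQF)
  exact partitionEntropy_le_of_coarser (hPF.prodMk (hQF.prodMk hRF))
    (fun w g => (w.1 g, w.2.1 g, w.2.2 g)) fun x => rfl

/-- The conditional entropy of the `F`-names of `P` given those of `Q` is at most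
`#F * H(P | Q)`, by the chain rule: each letter of the `P`-name contributes at most `H(P | Q)`. -/
lemma jointEntropy_prodMk_sub_le [SMulInvariantMeasure Γ X μ] {P : X → α} {Q : X → β}
    (hP : Measurable P) (hQ : Measurable Q) (F : Finset Γ) :
    jointEntropy μ (fun x => (P x, Q x)) F - jointEntropy μ Q F ≤
      F.card * (partitionEntropy μ (fun x => (P x, Q x)) - partitionEntropy μ Q) := by
  classical
  induction F using Finset.induction_on with
  | empty => simp [jointEntropy_empty]
  | insert a F ha ih =>
    have hPF := measurable_joinOver hP F
    have hQF := measurable_joinOver hQ F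
    have hPa : Measurable fun x => P (a • x) := hP.comp (measurable_const_smul a)
    have hQa : Measurable fun x => Q (a • x) := hQ.comp (measurable_const_smul a)
    -- `H(P_a | P^F, Q^F, Q_a) ≤ H(P_a | Q_a)`
    have h1 := partitionEntropy_submodular (μ := μ) (R := fun x => Q (a • x)) hPa
      (hPF.prodMk hQF)
    -- `H(P^F | Q_a, Q^F) ≤ H(P^F | Q^F)`
    have h2 := partitionEntropy_submodular (μ := μ) (R := joinOver Q F) hPF hQa
    have h3 : jointEntropy μ (fun x => (P x, Q x)) (insert a F) ≤ partitionEntropy μ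
        (fun x => (P (a • x), (joinOver P F x, joinOver Q F x), Q (a • x))) := by
      refine partitionEntropy_le_of_coarser (hPa.prodMk ((hPF.prodMk hQF).prodMk hQa))
        (fun w g => if hg : (g : Γ) ∈ F then (w.2.1.1 ⟨g, hg⟩, w.2.1.2 ⟨g, hg⟩)
          else (w.1, w.2.2)) fun x => ?_
      funext g
      split_ifs with hg
      · rfl
      · have : (g : Γ) = a := (Finset.mem_insert.1 g.2).resolve_right hg
        simp only [joinOver, this]
    have h4 : partitionEntropy μ (fun x => ((joinOver P F x, joinOver Q F x), Q (a • x))) ≤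
        partitionEntropy μ (fun x => (joinOver P F x, Q (a • x), joinOver Q F x)) :=
      partitionEntropy_le_of_coarser (hPF.prodMk (hQa.prodMk hQF))
        (fun w => ((w.1, w.2.2), w.2.1)) fun x => rfl
    have h5 : partitionEntropy μ (fun x => (Q (a • x), joinOver Q F x)) ≤
        jointEntropy μ Q (insert a F) :=
      partitionEntropy_le_of_coarser (measurable_joinOver hQ (insert a F))
        (fun w => (w ⟨a, Finset.mem_insert_self a F⟩,
          fun g => w ⟨g, Finset.mem_insert_of_mem g.2⟩)) fun x => rfl
    have h6 := partitionEntropy_comp_measurePreserving (hP.prodMk hQ)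
      (measurePreserving_smul a μ)
    have h7 := partitionEntropy_comp_measurePreserving hQ (measurePreserving_smul a μ)
    rw [jointEntropy_prodMk hP hQ] at ih
    have h8 : jointEntropy μ Q F = partitionEntropy μ (joinOver Q F) := rfl
    rw [Finset.card_insert_of_notMem ha]
    push_cast
    linarith

variable {H : ℕ → Finset Γ} [SMulInvariantMeasure Γ X μ]

lemma processEntropy_le_of_coarser (hH : IsFolnerSeq H) {P : X → α} {Q : X → β} (hP : Measurable P)
    (hQ : Measurable Q) (φ : β → α) (h : ∀ x, P x = φ (Q x)) :
    processEntropy H μ P ≤ processEntropy H μ Q :=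
  le_of_tendsto_of_tendsto' (tendsto_processEntropy hH hP) (tendsto_processEntropy hH hQ)
    fun i => mul_le_mul_of_nonneg_left (jointEntropy_le_of_coarser hQ φ h _) (by positivity)

lemma processEntropy_submodular (hH : IsFolnerSeq H) {P : X → α} {Q : X → β} {R : X → γ}
    (hP : Measurable P) (hQ : Measurable Q) (hR : Measurable R) :
    processEntropy H μ (fun x => (P x, Q x, R x)) + processEntropy H μ R ≤
      processEntropy H μ (fun x => (P x, R x)) + processEntropy H μ (fun x => (Q x, R x)) := by
  refine le_of_tendsto_of_tendsto'
    ((tendsto_processEntropy hH (hP.prodMk (hQ.prodMk hR))).add (tendsto_processEntropy hH hR))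
    ((tendsto_processEntropy hH (hP.prodMk hR)).add (tendsto_processEntropy hH (hQ.prodMk hR)))
    fun i => ?_
  rw [← mul_add, ← mul_add]
  exact mul_le_mul_of_nonneg_left (jointEntropy_submodular hP hQ hR _) (by positivity)

lemma processEntropy_prodMk_sub_le (hH : IsFolnerSeq H) {P : X → α} {Q : X → β} (hP : Measurable P)
    (hQ : Measurable Q) :
    processEntropy H μ (fun x => (P x, Q x)) - processEntropy H μ Q ≤
      partitionEntropy μ (fun x => (P x, Q x)) - partitionEntropy μ Q := by
  refine le_of_tendsto
    ((tendsto_processEntropy hH (hP.prodMk hQ)).sub (tendsto_processEntropy hH hQ)) ?_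
  filter_upwards [hH.eventually_nonempty] with i hi
  have hpos : (0 : ℝ) < (H i).card := by exact_mod_cast hi.card_pos
  rw [← mul_sub, inv_mul_le_iff₀ hpos]
  exact jointEntropy_prodMk_sub_le hP hQ _

lemma processEntropy_nonneg (hH : IsFolnerSeq H) {P : X → α} (hP : Measurable P) :
    0 ≤ processEntropy H μ P := by
  classical
  exact ge_of_tendsto' (tendsto_processEntropy hH hP) fun i =>
    mul_nonneg (by positivity) (partitionEntropy_nonneg _)

end Dynamics

/-! ### Conditional process entropy and the relative Pinsker algebra -/

section Infimum

variable {Γ X α : Type*} [Group Γ] [MulAction Γ X] {𝒜 : MeasurableSpace X} [MeasurableSpace X]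
  {μ : Measure X} {H : ℕ → Finset Γ} [Fintype α]

lemma le_condProcessEntropy {P : X → α} {c : ℝ}
    (h : ∀ (k : ℕ) (Q : X → Fin k), Measurable[𝒜] Q →
      c ≤ processEntropy H μ (fun x => (P x, Q x)) - processEntropy H μ Q) :
    c ≤ condProcessEntropy 𝒜 H μ P := by
  refine le_csInf ⟨_, 1, fun _ => 0, measurable_const, rfl⟩ ?_
  rintro _ ⟨k, Q, hQ, rfl⟩
  exact h k Q hQ

lemma exists_lt_of_condProcessEntropy_lt {P : X → α} {c : ℝ}
    (h : condProcessEntropy 𝒜 H μ P < c) :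
    ∃ (k : ℕ) (Q : X → Fin k), Measurable[𝒜] Q ∧
      processEntropy H μ (fun x => (P x, Q x)) - processEntropy H μ Q < c := by
  by_contra! hcon
  exact h.not_ge (le_condProcessEntropy hcon)

end Infimum

section Conditional

variable {Γ X : Type*} [Group Γ] [MulAction Γ X] {𝒜 : MeasurableSpace X} [mX : MeasurableSpace X]
  [MeasurableConstSMul Γ X] {μ : Measure X} [IsProbabilityMeasure μ] [SMulInvariantMeasure Γ X μ]
  {H : ℕ → Finset Γ}
variable {α β : Type*} [Fintype α] [Fintype β] [MeasurableSpace α] [MeasurableSingletonClass α]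
  [MeasurableSpace β] [MeasurableSingletonClass β]

lemma condProcessEntropy_nonneg (h𝒜 : 𝒜 ≤ mX) (hH : IsFolnerSeq H) {P : X → α}
    (hP : Measurable P) : 0 ≤ condProcessEntropy 𝒜 H μ P := by
  refine le_condProcessEntropy fun k Q hQ => sub_nonneg.2 ?_
  exact processEntropy_le_of_coarser hH (hQ.mono h𝒜 le_rfl)
    (hP.prodMk (hQ.mono h𝒜 le_rfl)) Prod.snd fun x => rfl

/-- In the infimum defining `h(T, P | 𝒜)`, partitions with labels in any finite type may be
used. -/
lemma condProcessEntropy_le (h𝒜 : 𝒜 ≤ mX) (hH : IsFolnerSeq H) {P : X → α}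
    (hP : Measurable P) {Q : X → β} (hQ : Measurable[𝒜] Q) :
    condProcessEntropy 𝒜 H μ P ≤
      processEntropy H μ (fun x => (P x, Q x)) - processEntropy H μ Q := by
  have hQm : Measurable Q := hQ.mono h𝒜 le_rfl
  set e := Fintype.equivFin β
  have he : Measurable e := measurable_of_countable e
  have heQ : Measurable fun x => e (Q x) := he.comp hQm
  have h1 : processEntropy H μ (fun x => e (Q x)) = processEntropy H μ Q :=
    (processEntropy_le_of_coarser hH heQ hQm e fun x => rfl).antisymm
      (processEntropy_le_of_coarser hH hQm heQ e.symm fun x => by simp)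
  have h2 : processEntropy H μ (fun x => (P x, e (Q x))) =
      processEntropy H μ (fun x => (P x, Q x)) :=
    (processEntropy_le_of_coarser hH (hP.prodMk heQ) (hP.prodMk hQm) (Prod.map id e)
      fun x => rfl).antisymm
      (processEntropy_le_of_coarser hH (hP.prodMk hQm) (hP.prodMk heQ) (Prod.map id e.symm)
        fun x => by simp)
  refine csInf_le ⟨0, ?_⟩ ⟨Fintype.card β, fun x => e (Q x), he.comp hQ, by rw [h1, h2]⟩
  rintro _ ⟨k, R, hR, rfl⟩
  exact sub_nonneg.2 (processEntropy_le_of_coarser hH (hR.mono h𝒜 le_rfl)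
    (hP.prodMk (hR.mono h𝒜 le_rfl)) Prod.snd fun x => rfl)

lemma condProcessEntropy_le_of_coarser (h𝒜 : 𝒜 ≤ mX) (hH : IsFolnerSeq H) {P : X → α} {P' : X → β}
    (hP : Measurable P) (hP' : Measurable P') (φ : β → α) (h : ∀ x, P x = φ (P' x)) :
    condProcessEntropy 𝒜 H μ P ≤ condProcessEntropy 𝒜 H μ P' := by
  refine le_condProcessEntropy fun k Q hQ => (condProcessEntropy_le h𝒜 hH hP hQ).trans ?_
  have hQm : Measurable Q := hQ.mono h𝒜 le_rfl
  exact sub_le_sub_right (processEntropy_le_of_coarser hH (hP.prodMk hQm) (hP'.prodMk hQm)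
    (Prod.map φ id) fun x => by simp [h]) _

lemma condProcessEntropy_eq_zero_of_measurable (h𝒜 : 𝒜 ≤ mX) (hH : IsFolnerSeq H) {P : X → α}
    (hP : Measurable[𝒜] P) : condProcessEntropy 𝒜 H μ P = 0 := by
  have hPm : Measurable P := hP.mono h𝒜 le_rfl
  refine le_antisymm ((condProcessEntropy_le h𝒜 hH hPm hP).trans (sub_nonpos.2 ?_))
    (condProcessEntropy_nonneg h𝒜 hH hPm)
  exact processEntropy_le_of_coarser hH (hPm.prodMk hPm) hPm (fun a => (a, a)) fun x => rfl

/-- Subadditivity `h(T, P ∨ P' | 𝒜) ≤ h(T, P | 𝒜) + h(T, P' | 𝒜)`: partitions that nearly attain the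
two infima on the right may be replaced by their join. -/
lemma condProcessEntropy_prodMk_le (h𝒜 : 𝒜 ≤ mX) (hH : IsFolnerSeq H) {P : X → α} {P' : X → β}
    (hP : Measurable P) (hP' : Measurable P') :
    condProcessEntropy 𝒜 H μ (fun x => (P x, P' x)) ≤
      condProcessEntropy 𝒜 H μ P + condProcessEntropy 𝒜 H μ P' := by
  refine le_of_forall_pos_le_add fun ε hε => ?_
  obtain ⟨k, Q, hQ, h⟩ := exists_lt_of_condProcessEntropy_lt
    (lt_add_of_pos_right (condProcessEntropy 𝒜 H μ P) (half_pos hε))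
  obtain ⟨k', Q', hQ', h'⟩ := exists_lt_of_condProcessEntropy_lt
    (lt_add_of_pos_right (condProcessEntropy 𝒜 H μ P') (half_pos hε))
  have hQm : Measurable Q := hQ.mono h𝒜 le_rfl
  have hQm' : Measurable Q' := hQ'.mono h𝒜 le_rfl
  have hR := hQm.prodMk hQm'
  have h1 := condProcessEntropy_le (μ := μ) h𝒜 hH (hP.prodMk hP') (hQ.prodMk hQ')
  have h2 := processEntropy_submodular (μ := μ) hH hP hP' hR
  have h3 := processEntropy_submodular (μ := μ) hH hP hQm' hQm
  have h4 := processEntropy_submodular (μ := μ) hH hP' hQm hQm'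
  have e1 := processEntropy_le_of_coarser (μ := μ) hH ((hP.prodMk hP').prodMk hR)
    (hP.prodMk (hP'.prodMk hR)) (fun w => ((w.1, w.2.1), w.2.2)) fun x => rfl
  have e2 := processEntropy_le_of_coarser (μ := μ) hH (hP.prodMk hR)
    (hP.prodMk (hQm'.prodMk hQm)) (fun w => (w.1, w.2.2, w.2.1)) fun x => rfl
  have e3 := processEntropy_le_of_coarser (μ := μ) hH (hQm'.prodMk hQm) hR
    Prod.swap fun x => rfl
  linarith

/-- The Rokhlin bound `h(T, P | 𝒜) ≤ h(T, P' | 𝒜) + H(P | P')`. -/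
lemma condProcessEntropy_le_add (h𝒜 : 𝒜 ≤ mX) (hH : IsFolnerSeq H) {P : X → α} {P' : X → β}
    (hP : Measurable P) (hP' : Measurable P') :
    condProcessEntropy 𝒜 H μ P ≤ condProcessEntropy 𝒜 H μ P' +
      (partitionEntropy μ (fun x => (P x, P' x)) - partitionEntropy μ P') := by
  rw [← sub_le_iff_le_add]
  refine le_condProcessEntropy fun k Q hQ => ?_
  have hQm : Measurable Q := hQ.mono h𝒜 le_rfl
  have h1 := condProcessEntropy_le (μ := μ) h𝒜 hH hP hQ
  have h2 := processEntropy_submodular (μ := μ) hH hP hQm hP'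
  have h3 := processEntropy_prodMk_sub_le (μ := μ) hH hP hP'
  have e1 := processEntropy_le_of_coarser (μ := μ) hH (hP.prodMk hQm)
    (hP.prodMk (hQm.prodMk hP')) (fun w => (w.1, w.2.1)) fun x => rfl
  have e2 := processEntropy_le_of_coarser (μ := μ) hH (hQm.prodMk hP') (hP'.prodMk hQm)
    Prod.swap fun x => rfl
  linarith

lemma condProcessEntropy_congr_ae (h𝒜 : 𝒜 ≤ mX) (hH : IsFolnerSeq H) {P P' : X → α}
    (hP : Measurable P) (hP' : Measurable P') (h : P =ᵐ[μ] P') :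
    condProcessEntropy 𝒜 H μ P = condProcessEntropy 𝒜 H μ P' := by
  suffices key : ∀ {P P' : X → α}, Measurable P → Measurable P' → P =ᵐ[μ] P' →
      condProcessEntropy 𝒜 H μ P ≤ condProcessEntropy 𝒜 H μ P' from
    (key hP hP' h).antisymm (key hP' hP h.symm)
  intro P P' hP hP' h
  have h1 := condProcessEntropy_le_add (μ := μ) h𝒜 hH hP hP'
  have h2 : partitionEntropy μ (fun x => (P x, P' x)) =
      partitionEntropy μ (fun x => (P' x, P' x)) :=
    partitionEntropy_congr_ae (by filter_upwards [h] with x hx; rw [hx])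
  have h3 := partitionEntropy_le_of_coarser (μ := μ) hP' (fun a => (a, a))
    (P := fun x => (P' x, P' x)) fun x => rfl
  linarith

/-- If `U n` increases to `U` then `H(U | U n) → 0`, where a set stands for the partition into it
and its complement. -/
lemma tendsto_partitionEntropy_mem {U : ℕ → Set X} (hU : ∀ n, MeasurableSet (U n))
    (hmono : Monotone U) :
    Tendsto (fun n => partitionEntropy μ (fun x => (x ∈ ⋃ i, U i, x ∈ U n)) -
      partitionEntropy μ (fun x => x ∈ U n)) atTop (𝓝 0) := by
  have hUm : MeasurableSet (⋃ i, U i) := MeasurableSet.iUnion hU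
  have h1 : Tendsto (fun n => μ.real (U n)) atTop (𝓝 (μ.real (⋃ i, U i))) :=
    (ENNReal.tendsto_toReal (measure_ne_top μ _)).comp (tendsto_measure_iUnion_atTop hmono)
  have e : ∀ n, partitionEntropy μ (fun x => (x ∈ ⋃ i, U i, x ∈ U n)) -
      partitionEntropy μ (fun x => x ∈ U n) =
      Real.negMulLog (μ.real (⋃ i, U i) - μ.real (U n)) +
        Real.negMulLog (1 - μ.real (⋃ i, U i)) - Real.negMulLog (1 - μ.real (U n)) := by
    intro n
    have hsub : U n ⊆ ⋃ i, U i := Set.subset_iUnion U n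
    have a1 : (fun x => (x ∈ ⋃ i, U i, x ∈ U n)) ⁻¹' {(True, True)} = U n := by
      ext x
      simpa using fun h => ⟨n, h⟩
    have a2 : (fun x => (x ∈ ⋃ i, U i, x ∈ U n)) ⁻¹' {(True, False)} = (⋃ i, U i) \ U n := by
      ext x
      simp
    have a3 : (fun x => (x ∈ ⋃ i, U i, x ∈ U n)) ⁻¹' {(False, True)} = ∅ := by
      ext x
      simpa using fun h h' => h n h'
    have a4 : (fun x => (x ∈ ⋃ i, U i, x ∈ U n)) ⁻¹' {(False, False)} = (⋃ i, U i)ᶜ := by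
      ext x
      simpa using fun h => h n
    have b1 : (fun x => x ∈ U n) ⁻¹' {True} = U n := by
      ext x
      simp
    have b2 : (fun x => x ∈ U n) ⁻¹' {False} = (U n)ᶜ := by
      ext x
      simp
    simp only [partitionEntropy, Fintype.sum_prod_type, Fintype.univ_Prop,
      Finset.sum_insert (show True ∉ ({False} : Finset Prop) by simp), Finset.sum_singleton,
      a1, a2, a3, a4, b1, b2, measureReal_empty, Real.negMulLog_zero,
      probReal_compl_eq_one_sub hUm, probReal_compl_eq_one_sub (hU n),
      measureReal_sdiff (μ := μ) hsub (hU n)]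
    ring
  simp only [e]
  have h2 := Real.continuous_negMulLog.continuousAt.tendsto.comp (h1.const_sub (μ.real (⋃ i, U i)))
  have h3 := Real.continuous_negMulLog.continuousAt.tendsto.comp (h1.const_sub 1)
  simpa using (h2.add_const (Real.negMulLog (1 - μ.real (⋃ i, U i)))).sub h3

/-- The sets `D` whose partition `{D, Dᶜ}` has zero entropy over `𝒜` form a σ-algebra. -/
@[reducible]
def zeroCondEntropyAlgebra (h𝒜 : 𝒜 ≤ mX) (hH : IsFolnerSeq H) (μ : Measure X)
    [IsProbabilityMeasure μ] [SMulInvariantMeasure Γ X μ] : MeasurableSpace X where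
  MeasurableSet' D := MeasurableSet D ∧ condProcessEntropy 𝒜 H μ (fun x => x ∈ D) = 0
  measurableSet_empty := ⟨MeasurableSet.empty,
    condProcessEntropy_eq_zero_of_measurable h𝒜 hH measurable_const⟩
  measurableSet_compl := fun D ⟨hD, h⟩ => ⟨hD.compl, le_antisymm
    (h ▸ condProcessEntropy_le_of_coarser h𝒜 hH hD.compl.mem hD.mem Not fun x => rfl)
    (condProcessEntropy_nonneg h𝒜 hH hD.compl.mem)⟩
  -- Finite unions are coarser than joins; a countable union is the limit of its partial unions.
  measurableSet_iUnion := by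
    intro D hD
    have hacc : ∀ n, MeasurableSet (Set.accumulate D n) ∧
        condProcessEntropy 𝒜 H μ (fun x => x ∈ Set.accumulate D n) = 0 := by
      intro n
      induction n with
      | zero => simpa using hD 0
      | succ n ih =>
        have hm : MeasurableSet (Set.accumulate D n ∪ D (n + 1)) := ih.1.union (hD _).1
        rw [Set.accumulate_succ]
        refine ⟨hm, le_antisymm ?_ (condProcessEntropy_nonneg h𝒜 hH hm.mem)⟩
        have h1 := condProcessEntropy_prodMk_le (μ := μ) h𝒜 hH ih.1.mem (hD (n + 1)).1.mem
        rw [ih.2, (hD (n + 1)).2, add_zero] at h1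
        exact (condProcessEntropy_le_of_coarser h𝒜 hH hm.mem (ih.1.mem.prodMk (hD (n + 1)).1.mem)
          (fun w => w.1 ∨ w.2) fun x => rfl).trans h1
    have hm : MeasurableSet (⋃ n, D n) := MeasurableSet.iUnion fun n => (hD n).1
    refine ⟨hm, le_antisymm ?_ (condProcessEntropy_nonneg h𝒜 hH hm.mem)⟩
    rw [← Set.iUnion_accumulate] at hm ⊢
    refine ge_of_tendsto' (tendsto_partitionEntropy_mem (μ := μ) (fun n => (hacc n).1)
      Set.monotone_accumulate) fun n => ?_
    have h1 := condProcessEntropy_le_add (μ := μ) h𝒜 hH hm.mem (hacc n).1.mem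
    rw [(hacc n).2, zero_add] at h1
    exact h1

lemma relativePinskerAlgebra_le_zeroCondEntropyAlgebra (h𝒜 : 𝒜 ≤ mX) (hH : IsFolnerSeq H) :
    relativePinskerAlgebra 𝒜 H μ ≤ zeroCondEntropyAlgebra h𝒜 hH μ := by
  refine MeasurableSpace.generateFrom_le ?_
  rintro _ ⟨k, P, j, hP, h, rfl⟩
  have hm : MeasurableSet (P ⁻¹' {j}) := hP (measurableSet_singleton j)
  exact ⟨hm, le_antisymm (h ▸ condProcessEntropy_le_of_coarser h𝒜 hH hm.mem hP (· = j)
    fun x => rfl) (condProcessEntropy_nonneg h𝒜 hH hm.mem)⟩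

lemma relativePinskerAlgebra_le (h𝒜 : 𝒜 ≤ mX) (hH : IsFolnerSeq H) :
    relativePinskerAlgebra 𝒜 H μ ≤ mX :=
  (relativePinskerAlgebra_le_zeroCondEntropyAlgebra h𝒜 hH).trans fun _ h => h.1

lemma condProcessEntropy_mem_eq_zero (h𝒜 : 𝒜 ≤ mX) (hH : IsFolnerSeq H) {D : Set X}
    (hD : MeasurableSet[relativePinskerAlgebra 𝒜 H μ] D) :
    condProcessEntropy 𝒜 H μ (fun x => x ∈ D) = 0 :=
  (relativePinskerAlgebra_le_zeroCondEntropyAlgebra h𝒜 hH D hD).2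

lemma le_relativePinskerAlgebra (h𝒜 : 𝒜 ≤ mX) (hH : IsFolnerSeq H) :
    𝒜 ≤ relativePinskerAlgebra 𝒜 H μ := by
  classical
  intro D hD
  have hP : Measurable[𝒜] fun x => if x ∈ D then (1 : Fin 2) else 0 :=
    Measurable.ite hD measurable_const measurable_const
  refine MeasurableSpace.measurableSet_generateFrom ⟨2, _, 1, hP.mono h𝒜 le_rfl,
    condProcessEntropy_eq_zero_of_measurable h𝒜 hH hP, ?_⟩
  ext x
  simp

/-- The relative Pinsker algebra is invariant under the symmetries of the action that preserve
`𝒜`. -/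
lemma measurable_relativePinskerAlgebra [Countable Γ] (h𝒜 : 𝒜 ≤ mX) (hH : IsFolnerSeq H)
    {R : X → X} (hR : MeasurePreserving R μ μ) (hR𝒜 : Measurable[𝒜, 𝒜] R)
    (hRc : ∀ g : Γ, ∀ᵐ x ∂μ, R (g • x) = g • R x) :
    Measurable[relativePinskerAlgebra 𝒜 H μ, relativePinskerAlgebra 𝒜 H μ] R := by
  refine @measurable_generateFrom _ _ (relativePinskerAlgebra 𝒜 H μ) _ _ ?_
  rintro _ ⟨k, P, j, hP, h, rfl⟩
  refine MeasurableSpace.measurableSet_generateFrom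
    ⟨k, fun x => P (R x), j, hP.comp hR.measurable, ?_, rfl⟩
  refine le_antisymm (h ▸ le_condProcessEntropy fun l Q hQ => ?_)
    (condProcessEntropy_nonneg h𝒜 hH (hP.comp hR.measurable))
  have hQm : Measurable Q := hQ.mono h𝒜 le_rfl
  rw [← processEntropy_comp H (hP.prodMk hQm) hR hRc, ← processEntropy_comp H hQm hR hRc]
  exact condProcessEntropy_le h𝒜 hH (hP.comp hR.measurable) (hQ.comp hR𝒜)

lemma measurableSet_pinskerAlgebra (hH : IsFolnerSeq H) {D : Set X} (hD : MeasurableSet D)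
    (h : processEntropy H μ (fun x => x ∈ D) ≤ 0) : MeasurableSet[pinskerAlgebra H μ] D := by
  classical
  have hP : Measurable fun x => if x ∈ D then (1 : Fin 2) else 0 :=
    Measurable.ite hD measurable_const measurable_const
  refine MeasurableSpace.measurableSet_generateFrom ⟨2, _, 1, hP, le_antisymm ?_
    (processEntropy_nonneg hH hP), ?_⟩
  · refine le_trans (processEntropy_le_of_coarser hH hP hD.mem
      (fun p => if p then 1 else 0) fun x => ?_) h
    congr
  · ext x
    simp

end Conditional

/-! ### Product actions -/

section Product

variable {Γ X Y : Type*} [Group Γ] [mX : MeasurableSpace X] [mY : MeasurableSpace Y]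
  [MulAction Γ X] [MulAction Γ Y] [MeasurableConstSMul Γ X] [MeasurableConstSMul Γ Y]

instance measurableConstSMul_prod : MeasurableConstSMul Γ (X × Y) where
  measurable_const_smul g :=
    ((measurable_const_smul g).comp measurable_fst).prodMk
      ((measurable_const_smul g).comp measurable_snd)

variable {μ : Measure X} {ν : Measure Y} [IsProbabilityMeasure μ] [IsProbabilityMeasure ν]
  [SMulInvariantMeasure Γ X μ] [SMulInvariantMeasure Γ Y ν] {H : ℕ → Finset Γ}

instance smulInvariantMeasure_prod : SMulInvariantMeasure Γ (X × Y) (μ.prod ν) where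
  measure_preimage_smul g _ hs :=
    ((measurePreserving_smul g μ).prod (measurePreserving_smul g ν)).measure_preimage
      hs.nullMeasurableSet

variable {α β : Type*} [Fintype α] [Fintype β] [MeasurableSpace α] [MeasurableSingletonClass α]
  [MeasurableSpace β] [MeasurableSingletonClass β]

/-- The names of partitions of the two coordinates are independent, so that entropies add up. -/
lemma processEntropy_prod_eq_add [Countable Γ] (hH : IsFolnerSeq H) {P : Y → α} (hP : Measurable P)
    {Q : X → β} (hQ : Measurable Q) :
    processEntropy H (μ.prod ν) (fun x => (P x.2, Q x.1)) =
      processEntropy H ν P + processEntropy H (μ.prod ν) (fun x => Q x.1) := by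
  classical
  rw [← processEntropy_comp H hP (measurePreserving_snd (μ := μ) (ν := ν))
    fun g => ae_of_all _ fun x => rfl]
  have hP' : Measurable fun x : X × Y => P x.2 := hP.comp measurable_snd
  have hQ' : Measurable fun x : X × Y => Q x.1 := hQ.comp measurable_fst
  refine tendsto_nhds_unique (tendsto_processEntropy hH (hP'.prodMk hQ')) ?_
  refine ((tendsto_processEntropy hH hP').add (tendsto_processEntropy hH hQ')).congr fun i => ?_
  rw [← mul_add, jointEntropy_prodMk hP' hQ', partitionEntropy_prod_of_indep
    (measurable_joinOver hP' _) (measurable_joinOver hQ' _)]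
  · rfl
  · intro a b
    have e1 : joinOver (fun x : X × Y => P x.2) (H i) ⁻¹' {a} =
        Set.univ ×ˢ (joinOver P (H i) ⁻¹' {a}) := by
      rw [Set.univ_prod]
      rfl
    have e2 : joinOver (fun x : X × Y => Q x.1) (H i) ⁻¹' {b} =
        (joinOver Q (H i) ⁻¹' {b}) ×ˢ Set.univ := by
      rw [Set.prod_univ]
      rfl
    rw [e1, e2, Set.prod_inter_prod, Set.univ_inter, Set.inter_univ]
    simp only [measureReal_prod_prod, probReal_univ, one_mul, mul_one]
    rw [mul_comm]

/-- As the two coordinates are independent, conditioning on the first one does not lower the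
entropy of a partition of the second. -/
lemma processEntropy_le_condProcessEntropy_snd [Countable Γ] (hH : IsFolnerSeq H) {P : Y → α}
    (hP : Measurable P) :
    processEntropy H ν P ≤
      condProcessEntropy (mX.comap Prod.fst) H (μ.prod ν) (fun x => P x.2) := by
  refine le_condProcessEntropy fun k Q hQ => ?_
  have : Nonempty (Fin k) := (nonempty_of_isProbabilityMeasure (μ.prod ν)).map Q
  obtain ⟨Q', hQ', rfl⟩ := hQ.exists_eq_measurable_comp
  have := processEntropy_prod_eq_add (μ := μ) (ν := ν) hH hP hQ'
  simp only [Function.comp_def]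
  linarith

lemma comap_snd_pinskerAlgebra_le [Countable Γ] (hH : IsFolnerSeq H) :
    (pinskerAlgebra H ν).comap Prod.snd ≤
      relativePinskerAlgebra (mX.comap Prod.fst) H (μ.prod ν) := by
  have h𝒜 : mX.comap Prod.fst ≤ (inferInstance : MeasurableSpace (X × Y)) :=
    measurable_fst.comap_le
  rw [pinskerAlgebra, MeasurableSpace.comap_generateFrom]
  refine MeasurableSpace.generateFrom_le ?_
  rintro _ ⟨_, ⟨k, P, j, hP, h, rfl⟩, rfl⟩
  have hP' : Measurable fun x : X × Y => P x.2 := hP.comp measurable_snd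
  refine MeasurableSpace.measurableSet_generateFrom ⟨k, _, j, hP', ?_, rfl⟩
  refine le_antisymm ?_ (condProcessEntropy_nonneg h𝒜 hH hP')
  refine (condProcessEntropy_le h𝒜 hH hP' (Q := fun _ => ()) measurable_const).trans ?_
  have h1 := processEntropy_nonneg (μ := μ.prod ν) hH
    (measurable_const (a := ()) : Measurable fun _ : X × Y => ())
  have h2 := processEntropy_le_of_coarser (μ := μ.prod ν) hH
    (hP'.prodMk measurable_const) hP' (fun a => (a, ())) fun x => rfl
  rw [processEntropy_comp H hP (measurePreserving_snd (μ := μ) (ν := ν))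
    fun g => ae_of_all _ fun x => rfl, h] at h2
  linarith

/-- A cylinder over `B` that lies in the relative Pinsker algebra, up to a null set, has its base
`B` in the Pinsker algebra of the second factor. -/
lemma measurableSet_pinskerAlgebra_of_cylinder [Countable Γ] (hH : IsFolnerSeq H) {B : Set Y}
    (hB : MeasurableSet B) {D : Set (X × Y)}
    (hD : MeasurableSet[relativePinskerAlgebra (mX.comap Prod.fst) H (μ.prod ν)] D)
    (h : Prod.snd ⁻¹' B =ᵐ[μ.prod ν] D) : MeasurableSet[pinskerAlgebra H ν] B := by
  have h𝒜 : mX.comap Prod.fst ≤ (inferInstance : MeasurableSpace (X × Y)) :=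
    measurable_fst.comap_le
  refine measurableSet_pinskerAlgebra hH hB ?_
  refine (processEntropy_le_condProcessEntropy_snd (μ := μ) hH hB.mem).trans (le_of_eq ?_)
  rw [← condProcessEntropy_mem_eq_zero h𝒜 hH hD]
  exact condProcessEntropy_congr_ae h𝒜 hH (hB.mem.comp measurable_snd)
    (relativePinskerAlgebra_le h𝒜 hH D hD).mem h

end Product

/-! ### Functions and conditional expectations invariant under an ergodic group -/

section Invariance

lemma ae_eq_const_of_forall_smul_ae_eq {G X : Type*} [SMul G X] [MeasurableSpace X] {μ : Measure X}
    [ErgodicSMul G X μ] {g : X → ℝ} (hg : Measurable g)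
    (h : ∀ s : G, (fun x => g (s • x)) =ᵐ[μ] g) : ∃ c, g =ᵐ[μ] Function.const X c := by
  refine exists_eventuallyEq_const_of_forall_separating MeasurableSet fun U hU => ?_
  refine eventuallyConst_set.1 (aeconst_of_forall_preimage_smul_ae_eq G
    (s := g ⁻¹' U) (hg hU).nullMeasurableSet fun s => ?_)
  filter_upwards [h s] with x hx
  exact congrArg (· ∈ U) hx

variable {X Y : Type*} [MeasurableSpace X] [MeasurableSpace Y]

lemma ae_eq_of_forall_setIntegral_prod_eq {ρ : Measure (X × Y)} [IsFiniteMeasure ρ]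
    {f g : X × Y → ℝ}
    (hf : Integrable f ρ) (hg : Integrable g ρ)
    (h : ∀ (A : Set X) (B : Set Y), MeasurableSet A → MeasurableSet B →
      ∫ z in A ×ˢ B, f z ∂ρ = ∫ z in A ×ˢ B, g z ∂ρ) : f =ᵐ[ρ] g := by
  have huniv : ∫ z, f z ∂ρ = ∫ z, g z ∂ρ := by
    simpa using h Set.univ Set.univ MeasurableSet.univ MeasurableSet.univ
  refine Integrable.ae_eq_of_forall_setIntegral_eq f g hf hg fun s hs _ => ?_
  induction s, hs using MeasurableSpace.induction_on_inter generateFrom_prod.symm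
    isPiSystem_prod with
  | empty => simp
  | basic t ht =>
    obtain ⟨A, hA, B, hB, rfl⟩ := ht
    exact h A B hA hB
  | compl t ht ih =>
    rw [setIntegral_compl ht hf, setIntegral_compl ht hg, huniv, ih (measure_lt_top ρ t)]
  | iUnion t hd ht ih =>
    rw [integral_iUnion ht hd hf.integrableOn, integral_iUnion ht hd hg.integrableOn]
    exact tsum_congr fun i => ih i (measure_lt_top ρ (t i))

/-- A function on a product which is invariant under a group acting ergodically on the first factor
depends on the second coordinate only. -/
lemma ae_eq_integral_of_forall_smul_ae_eq {G : Type*} [SMul G X] {μ : Measure X} {ν : Measure Y}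
    [IsProbabilityMeasure μ] [IsProbabilityMeasure ν] [ErgodicSMul G X μ] {f : X × Y → ℝ}
    (hfm : StronglyMeasurable f) (hf : Integrable f (μ.prod ν))
    (h : ∀ s : G, (fun z : X × Y => f (s • z.1, z.2)) =ᵐ[μ.prod ν] f) :
    f =ᵐ[μ.prod ν] fun z => ∫ x, f (x, z.2) ∂μ := by
  have hw : Integrable (fun y => ∫ x, f (x, y) ∂μ) ν := hf.integral_prod_right
  have hw' : Integrable (fun z : X × Y => ∫ x, f (x, z.2) ∂μ) (μ.prod ν) := hw.comp_snd μ
  refine ae_eq_of_forall_setIntegral_prod_eq hf hw' fun A B hA hB => ?_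
  set g : X → ℝ := fun x => ∫ y in B, f (x, y) ∂ν
  have hgm : Measurable g := (hfm.integral_prod_right' (ν := ν.restrict B)).measurable
  obtain ⟨c, hc⟩ := ae_eq_const_of_forall_smul_ae_eq (G := G) (μ := μ) hgm fun s => by
    filter_upwards [Measure.ae_ae_of_ae_prod (h s)] with x hx
    exact setIntegral_congr_ae hB (hx.mono fun y hy _ => hy)
  have h1 : ∀ A : Set X, MeasurableSet A → ∫ z in A ×ˢ B, f z ∂μ.prod ν = μ.real A * c := by
    intro A hA
    rw [setIntegral_prod f hf.integrableOn,
      setIntegral_congr_ae hA (hc.mono fun x hx _ => hx)]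
    simp
  have h2 : ∫ y in B, ∫ x, f (x, y) ∂μ ∂ν = c := by
    have h3 := h1 Set.univ MeasurableSet.univ
    rw [probReal_univ, one_mul] at h3
    rw [← h3, ← Measure.prod_restrict, Measure.restrict_univ]
    refine (integral_prod_symm f ?_).symm
    have := hf.integrableOn (s := Set.univ ×ˢ B)
    rwa [IntegrableOn, ← Measure.prod_restrict, Measure.restrict_univ] at this
  rw [h1 A hA, setIntegral_prod _ hw'.integrableOn]
  simp [h2]

/-- An automorphism preserving the σ-algebra `m` and the function `f` preserves `ρ[f | m]`. -/
lemma condExp_comp_ae_eq {Z : Type*} {m mZ : MeasurableSpace Z} {ρ : Measure Z}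
    [IsFiniteMeasure ρ] (hm : m ≤ mZ) (R : Z ≃ Z) (hR : MeasurePreserving R ρ ρ)
    (hR' : Measurable R.symm) (hRm : Measurable[m, m] R) (hRm' : Measurable[m, m] R.symm)
    {f : Z → ℝ} (hf : Integrable f ρ) (hfR : ∀ z, f (R z) = f z) :
    (fun z => ρ[f | m] (R z)) =ᵐ[ρ] ρ[f | m] := by
  have hemb : MeasurableEmbedding R :=
    MeasurableEquiv.measurableEmbedding ⟨R, hR.measurable, hR'⟩
  refine ae_eq_condExp_of_forall_setIntegral_eq hm hf (fun s _ _ => ?_) (fun s hs _ => ?_) ?_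
  · exact ((hR.integrable_comp_emb hemb).2 integrable_condExp).integrableOn
  · have hs' : MeasurableSet[m] (R.symm ⁻¹' s) := hRm' hs
    have e : s = R ⁻¹' (R.symm ⁻¹' s) := by
      ext z
      simp
    rw [e, hR.setIntegral_preimage_emb hemb, setIntegral_condExp hm hf hs',
      ← hR.setIntegral_preimage_emb hemb]
    simp only [hfR]
  · exact (stronglyMeasurable_condExp.comp_measurable hRm).aestronglyMeasurable

end Invariance

/-! ### σ-algebras between the first coordinate algebra and the product -/

section Intermediate

variable {X Y : Type*} [mX : MeasurableSpace X] [mY : MeasurableSpace Y] {μ : Measure X}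
  {ν : Measure Y} [IsProbabilityMeasure μ] [IsProbabilityMeasure ν]

/-- In the integral over a rectangle of a function measurable for a σ-algebra `m` that contains
that of `X`, only the conditional expectation on `m` of the cylinder over `B` matters. -/
lemma setIntegral_prod_eq_setIntegral_mul_condExp {ρ : Measure (X × Y)} [IsFiniteMeasure ρ]
    {m : MeasurableSpace (X × Y)} (hm : m ≤ mX.prod mY) (hfst : mX.comap Prod.fst ≤ m)
    {u : X × Y → ℝ} (hu : StronglyMeasurable[m] u) (hui : Integrable u ρ)
    {A : Set X} {B : Set Y} (hA : MeasurableSet A) (hB : MeasurableSet B) :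
    ∫ z in A ×ˢ B, u z ∂ρ = ∫ z in Prod.fst ⁻¹' A, u z *
      ρ[(Prod.snd ⁻¹' B).indicator (fun _ : X × Y => (1 : ℝ)) | m] z ∂ρ := by
  have hB' : MeasurableSet[mX.prod mY] (Prod.snd ⁻¹' B : Set (X × Y)) := measurable_snd hB
  have hA' : MeasurableSet[m] (Prod.fst ⁻¹' A : Set (X × Y)) := hfst _ ⟨A, hA, rfl⟩
  have e : u * (Prod.snd ⁻¹' B).indicator (fun _ : X × Y => (1 : ℝ)) =
      (Prod.snd ⁻¹' B).indicator u := by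
    ext z
    by_cases hz : z ∈ (Prod.snd ⁻¹' B : Set (X × Y)) <;> simp [hz]
  have hi : Integrable (u * (Prod.snd ⁻¹' B).indicator (fun _ : X × Y => (1 : ℝ))) ρ :=
    e ▸ hui.indicator hB'
  have h1 := condExp_mul_of_stronglyMeasurable_left hu hi
    ((integrable_const (1 : ℝ)).indicator hB')
  rw [Set.prod_eq, ← setIntegral_indicator hB', ← e, ← setIntegral_condExp hm hi hA']
  exact setIntegral_congr_ae (hm _ hA') (h1.mono fun z hz _ => hz)

/-- Let `m` be a σ-algebra between that of `X` and that of `X × Y`. If the conditional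
expectations on `m` of all cylinders over `Y` are measurable for a smaller σ-algebra `m'`, which
also contains that of `X`, then `m = m'` up to null sets. -/
lemma exists_ae_eq_of_condExp_cylinder {ρ : Measure (X × Y)} [IsFiniteMeasure ρ]
    {m m' : MeasurableSpace (X × Y)} (hm : m ≤ mX.prod mY) (hm' : m' ≤ m)
    (hfst : mX.comap Prod.fst ≤ m')
    (h : ∀ B : Set Y, MeasurableSet B → ∃ w : X × Y → ℝ, StronglyMeasurable[m'] w ∧
      ρ[(Prod.snd ⁻¹' B).indicator (fun _ : X × Y => (1 : ℝ)) | m] =ᵐ[ρ] w)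
    {C : Set (X × Y)} (hC : MeasurableSet[m] C) : ∃ D, MeasurableSet[m'] D ∧ C =ᵐ[ρ] D := by
  set q : X × Y → ℝ := C.indicator fun _ => 1
  have hq : StronglyMeasurable[m] q := stronglyMeasurable_const.indicator hC
  have hqi : Integrable q ρ := (integrable_const (1 : ℝ)).indicator (hm C hC)
  have hp : StronglyMeasurable[m'] (ρ[q | m']) := stronglyMeasurable_condExp
  have key : q =ᵐ[ρ] ρ[q | m'] := by
    refine ae_eq_of_forall_setIntegral_prod_eq hqi integrable_condExp fun A B hA hB => ?_
    have hA' : MeasurableSet[m'] (Prod.fst ⁻¹' A : Set (X × Y)) := hfst _ ⟨A, hA, rfl⟩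
    obtain ⟨w, hw, hwe⟩ := h B hB
    rw [setIntegral_prod_eq_setIntegral_mul_condExp hm (hfst.trans hm') hq hqi hA hB,
      setIntegral_prod_eq_setIntegral_mul_condExp hm (hfst.trans hm') (hp.mono hm')
        integrable_condExp hA hB]
    have hwi : Integrable w ρ := integrable_condExp.congr hwe
    have e : w * q = C.indicator w := by
      ext z
      by_cases hz : z ∈ C <;> simp [q, hz]
    have hi : Integrable (w * q) ρ := e ▸ hwi.indicator (hm C hC)
    -- Pulling `w` out of the expectation on `m'` moves the condition from `w` to the indicator `q`.
    have h1 := condExp_mul_of_stronglyMeasurable_left hw hi hqi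
    have hA'' := hm _ (hm' _ hA')
    calc ∫ z in Prod.fst ⁻¹' A, q z *
          ρ[(Prod.snd ⁻¹' B).indicator (fun _ : X × Y => (1 : ℝ)) | m] z ∂ρ
        = ∫ z in Prod.fst ⁻¹' A, (w * q) z ∂ρ :=
          setIntegral_congr_ae hA'' (hwe.mono fun z hz _ => by rw [hz, Pi.mul_apply, mul_comm])
      _ = ∫ z in Prod.fst ⁻¹' A, (ρ[w * q | m']) z ∂ρ :=
          (setIntegral_condExp (hm'.trans hm) hi hA').symm
      _ = _ := by
          refine setIntegral_congr_ae hA'' ?_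
          filter_upwards [h1, hwe] with z hz hz' _
          rw [hz, hz', Pi.mul_apply, mul_comm]
  refine ⟨ρ[q | m'] ⁻¹' {1}, hp.measurable (measurableSet_singleton 1), ?_⟩
  filter_upwards [key] with z hz
  refine propext ?_
  change z ∈ C ↔ ρ[q | m'] z = 1
  rw [← hz]
  by_cases h : z ∈ C <;> simp [q, h]

end Intermediate

/-! ### The relative Pinsker algebra of a product -/

section Main

variable {Γ X Y : Type*} [Group Γ] [Countable Γ] [mX : MeasurableSpace X] [mY : MeasurableSpace Y]
  {μ : Measure X} {ν : Measure Y} [IsProbabilityMeasure μ] [IsProbabilityMeasure ν]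
  [MulAction Γ X] [MulAction Γ Y] [MeasurableConstSMul Γ X] [MeasurableConstSMul Γ Y]
  [SMulInvariantMeasure Γ X μ] [SMulInvariantMeasure Γ Y ν] {H : ℕ → Finset Γ}

/-- If `S` commutes with the action on `X`, then `S × id` preserves the relative Pinsker algebra of
the product over `X`. -/
lemma measurable_prodCongr_refl (hH : IsFolnerSeq H) {S : Equiv.Perm X}
    (hS : S ∈ centralizer Γ μ) :
    MeasurePreserving (Equiv.prodCongr S (Equiv.refl Y)) (μ.prod ν) (μ.prod ν) ∧
      Measurable[relativePinskerAlgebra (mX.comap Prod.fst) H (μ.prod ν),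
        relativePinskerAlgebra (mX.comap Prod.fst) H (μ.prod ν)]
        (Equiv.prodCongr S (Equiv.refl Y)) := by
  have h1 : MeasurePreserving (Equiv.prodCongr S (Equiv.refl Y)) (μ.prod ν) (μ.prod ν) :=
    hS.1.prod (MeasurePreserving.id ν)
  refine ⟨h1, measurable_relativePinskerAlgebra measurable_fst.comap_le hH h1 ?_ fun g => ?_⟩
  · rintro _ ⟨A, hA, rfl⟩
    exact ⟨S ⁻¹' A, hS.1.measurable hA, rfl⟩
  · filter_upwards [Measure.quasiMeasurePreserving_fst.ae (hS.2.2 g)] with z hz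
    exact Prod.ext hz rfl

/-- The conditional expectation of a cylinder over `Y` on the relative Pinsker algebra is a
function on `Y` which is measurable for the Pinsker algebra. -/
lemma exists_condExp_cylinder_ae_eq (hH : IsFolnerSeq H)
    [ErgodicSMul (centralizer Γ μ) X μ] {B : Set Y} (hB : MeasurableSet B) :
    ∃ w : Y → ℝ, Measurable[pinskerAlgebra H ν] w ∧
      (μ.prod ν)[(Prod.snd ⁻¹' B).indicator (fun _ : X × Y => (1 : ℝ)) |
        relativePinskerAlgebra (mX.comap Prod.fst) H (μ.prod ν)] =ᵐ[μ.prod ν]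
          fun z => w z.2 := by
  have hE : relativePinskerAlgebra (mX.comap Prod.fst) H (μ.prod ν) ≤ mX.prod mY :=
    relativePinskerAlgebra_le measurable_fst.comap_le hH
  have hB' : MeasurableSet (Prod.snd ⁻¹' B : Set (X × Y)) := measurable_snd hB
  set f := (μ.prod ν)[(Prod.snd ⁻¹' B).indicator (fun _ : X × Y => (1 : ℝ)) |
    relativePinskerAlgebra (mX.comap Prod.fst) H (μ.prod ν)]
  have hfE : StronglyMeasurable[relativePinskerAlgebra (mX.comap Prod.fst) H (μ.prod ν)] f :=
    stronglyMeasurable_condExp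
  have hinv : ∀ S : centralizer Γ μ,
      (fun z : X × Y => f (S • z.1, z.2)) =ᵐ[μ.prod ν] f := by
    intro S
    have h1 := measurable_prodCongr_refl (ν := ν) hH S.2
    have h2 := measurable_prodCongr_refl (ν := ν) hH (inv_mem S.2)
    exact condExp_comp_ae_eq hE (Equiv.prodCongr (S : Equiv.Perm X) (Equiv.refl Y)) h1.1
      h2.1.measurable h1.2 h2.2 ((integrable_const (1 : ℝ)).indicator hB') fun z => rfl
  have hfw := ae_eq_integral_of_forall_smul_ae_eq (hfE.mono hE) integrable_condExp hinv
  have hwm : Measurable fun y => ∫ x, f (x, y) ∂μ :=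
    ((hfE.mono hE).integral_prod_left' (μ := μ)).measurable
  refine ⟨fun y => ∫ x, f (x, y) ∂μ, fun U hU => ?_, hfw⟩
  refine measurableSet_pinskerAlgebra_of_cylinder (μ := μ) hH (hwm hU)
    (hfE.measurable hU) ?_
  filter_upwards [hfw] with z hz
  exact congrArg (· ∈ U) hz.symm

end Main

end AmenableEntropy

open AmenableEntropy in
theorem theorem4p10
    {Γ : Type*} [Group Γ] [Countable Γ]
    (H : ℕ → Finset Γ) (hH : AmenableEntropy.IsFolnerSeq H)
    {X₁ : Type*} [B₁ : MeasurableSpace X₁] [StandardBorelSpace X₁]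
    (μ₁ : Measure X₁) [IsProbabilityMeasure μ₁]
    [MulAction Γ X₁] [MeasurableConstSMul Γ X₁] [ErgodicSMul Γ X₁ μ₁]
    {X₂ : Type*} [B₂ : MeasurableSpace X₂] [StandardBorelSpace X₂]
    (μ₂ : Measure X₂) [IsProbabilityMeasure μ₂]
    [MulAction Γ X₂] [MeasurableConstSMul Γ X₂] [ErgodicSMul Γ X₂ μ₂]
    (hC : ErgodicSMul (AmenableEntropy.centralizer Γ μ₁) X₁ μ₁) :
    eventuallyMeasurableSpace
        (AmenableEntropy.relativePinskerAlgebra (B₁.comap Prod.fst) H (μ₁.prod μ₂))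
        (ae (μ₁.prod μ₂)) =
      eventuallyMeasurableSpace
        (B₁.prod (AmenableEntropy.pinskerAlgebra H μ₂))
        (ae (μ₁.prod μ₂)) := by
  have hE : relativePinskerAlgebra (B₁.comap Prod.fst) H (μ₁.prod μ₂) ≤ B₁.prod B₂ :=
    relativePinskerAlgebra_le measurable_fst.comap_le hH
  have hle : B₁.prod (pinskerAlgebra H μ₂) ≤
      relativePinskerAlgebra (B₁.comap Prod.fst) H (μ₁.prod μ₂) :=
    sup_le (le_relativePinskerAlgebra measurable_fst.comap_le hH) (comap_snd_pinskerAlgebra_le hH)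
  refine le_antisymm ?_ fun s ⟨t, ht, hst⟩ => ⟨t, hle t ht, hst⟩
  rintro s ⟨t, ht, hst⟩
  have hw : ∀ B : Set X₂, MeasurableSet B → ∃ w : X₁ × X₂ → ℝ,
      StronglyMeasurable[B₁.prod (pinskerAlgebra H μ₂)] w ∧
      (μ₁.prod μ₂)[(Prod.snd ⁻¹' B).indicator (fun _ : X₁ × X₂ => (1 : ℝ)) |
        relativePinskerAlgebra (B₁.comap Prod.fst) H (μ₁.prod μ₂)] =ᵐ[μ₁.prod μ₂] w := by
    intro B hB
    obtain ⟨w, hw, hwe⟩ := exists_condExp_cylinder_ae_eq (μ := μ₁) (ν := μ₂) hH hB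
    refine ⟨fun z => w z.2, Measurable.stronglyMeasurable fun U hU => ?_, hwe⟩
    exact (le_sup_right : (pinskerAlgebra H μ₂).comap Prod.snd ≤ _) _ ⟨w ⁻¹' U, hw hU, rfl⟩
  obtain ⟨D, hD, htD⟩ := exists_ae_eq_of_condExp_cylinder hE hle le_sup_left hw ht
  exact ⟨D, hD, hst.trans htD⟩
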